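/- **BK→JW conversion depth.** Encode $N$ fermionic modes into $N$ qubits $0,\dots,N-1$ by a binary-shaped ternary tree with $N$ nodes: every node is a qubit, qubits are numbered by in-order traversal, each node has a left, a middle and a right child, and the middle child is always a leaf. Number the $2N+1$ leaves from left to right. The Majorana operator $\gamma_j$ ($0\le j<2N$) is encoded as the Pauli string of the root-to-leaf path of leaf $j$, where a step to the left, middle or right child at the node of qubit $q$ contributes $X_q$, $Y_q$ or $Z_q$; the last leaf is unused. The Jordan–Wigner (JW) tree is the right spine and the Parity tree is the left spine. The Bravyi–Kitaev (BK) tree is the balanced (Fenwick) tree: with $p=2^{\lfloor\log_2 N\rfloor}$, the root has a BK tree on $p-1$ nodes as its left subtree and a BK tree on $N-p$ nodes as its right subtree (for $N=2^k-1$ this is the perfect binary tree). A unitary $U$ performs the basis transformation from one encoding to another if $U\gamma_jU^\dagger=\gamma'_j$ for all $0\le j<2N$, where $\gamma_j$ and $\gamma'_j$ are the encoded Majorana operators of the first and of the second encoding. There is an absolute constant $C$ with the following property. Let $L=2^m$ with $m \ge 0$, let $N\le L^2$ (in particular $N=L^2$ or $N=L^2-1$), and place qubit $i$ on the $i$-th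 cell of the Hilbert curve of order $m$ on the $L\times L$ grid. Then: 1. the BK→JW basis transformation is performed by a nearest-neighbour CNOT circuit on these $N$ qubits (no ancillas) of depth at most $C\sqrt N$; 2. the Parity→BK basis transformation is likewise performed by a nearest-neighbour CNOT circuit on these $N$ qubits of depth at most $C\sqrt N$. Here a circuit is a sequence of layers, its depth is the number of layers, and each layer consists of CNOT gates on pairwise disjoint pairs of qubits that sit on horizontally or vertically adjacent cells. -/

import Mathlib

namespace GridFermion

/-! ### Binary-shaped ternary tree encodings -/

/-- The shape of a binary-shaped ternary tree. Every node is a qubit with three ordered children: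
a left subtree, a middle child which is always a leaf, and a right subtree. Only the left and right
subtrees are recorded; `nil` is a leaf. A shape with `n` nodes thus has `2 * n + 1` leaves. -/
abbrev TreeShape : Type := BinaryTree Unit

/-- The node with given left and right subtrees (and a middle leaf). -/
abbrev TreeShape.branch (l r : TreeShape) : TreeShape := BinaryTree.node () l r

/-- Jordan--Wigner tree on `n` nodes: the right spine. -/
def jwTree : ℕ → TreeShape
  | 0 => .nil
  | n + 1 => TreeShape.branch .nil (jwTree n)

/-- Parity tree on `n` nodes: the left spine. -/
def parityTree : ℕ → TreeShape
  | 0 => .nil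
  | n + 1 => TreeShape.branch (parityTree n) .nil

/-- Bravyi--Kitaev (Fenwick) tree on `n` nodes. If `p = 2 ^ ⌊log₂ n⌋` is the largest power of two
with `p ≤ n`, the left subtree of the root has `p - 1` nodes and the right subtree has the remaining
`n - p` nodes. For `n = 2 ^ k - 1` it is the perfect binary tree with `k` levels
(see `bkTree_two_pow_sub_one`); for every `n` it has the least possible height. -/
def bkTree (n : ℕ) : TreeShape :=
  if n = 0 then .nil
  else TreeShape.branch (bkTree (2 ^ Nat.log 2 n - 1)) (bkTree (n - 2 ^ Nat.log 2 n))
termination_by n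
decreasing_by
  · have := Nat.pow_log_le_self 2 (x := n) (by omega)
    omega
  · have := Nat.two_pow_pos (Nat.log 2 n)
    omega

theorem numNodes_jwTree (n : ℕ) : (jwTree n).numNodes = n := by
  induction n with
  | zero => rfl
  | succ n ih => simp [jwTree, ih]

theorem numNodes_parityTree (n : ℕ) : (parityTree n).numNodes = n := by
  induction n with
  | zero => rfl
  | succ n ih => simp [parityTree, ih]

theorem numNodes_bkTree (n : ℕ) : (bkTree n).numNodes = n := by
  induction n using Nat.strong_induction_on with
  | _ n ih =>
    rw [bkTree]
    split_ifs with h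
    · simp [h]
    · have h1 := Nat.pow_log_le_self 2 h
      have h2 := Nat.two_pow_pos (Nat.log 2 n)
      simp only [BinaryTree.numNodes]
      rw [ih _ (by omega), ih _ (by omega)]
      omega

/-- On `2 ^ k - 1` nodes the Bravyi--Kitaev tree is the perfect binary tree. -/
theorem bkTree_two_pow_sub_one (k : ℕ) :
    bkTree (2 ^ (k + 1) - 1) =
      TreeShape.branch (bkTree (2 ^ k - 1)) (bkTree (2 ^ k - 1)) := by
  have hk := Nat.two_pow_pos k
  have hlog : Nat.log 2 (2 ^ (k + 1) - 1) = k := by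
    apply Nat.log_eq_of_pow_le_of_lt_pow <;> rw [pow_succ] <;> omega
  rw [bkTree, if_neg (by rw [pow_succ]; omega), hlog]
  congr 2
  rw [pow_succ]; omega

/-! ### Pauli strings and Majorana operators -/

/-- The Pauli matrix `X`. -/
def pauliX : Matrix (Fin 2) (Fin 2) ℂ := !![0, 1; 1, 0]

/-- The Pauli matrix `Y`. -/
def pauliY : Matrix (Fin 2) (Fin 2) ℂ := !![0, -Complex.I; Complex.I, 0]

/-- The Pauli matrix `Z`. -/
def pauliZ : Matrix (Fin 2) (Fin 2) ℂ := !![1, 0; 0, -1]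

/-- `leafPauli t j q` is the single-qubit factor on qubit `q` of the Pauli string read off from the
path from the root of `t` to its `j`-th leaf. Qubits label the nodes `0, 1, …` by in-order
traversal and leaves are numbered `0, 1, …` from left to right. At each node on the path, a step to
the left, middle or right child contributes `X`, `Y` or `Z` on the qubit of that node; qubits off the
path get the identity. -/
def leafPauli : TreeShape → ℕ → ℕ → Matrix (Fin 2) (Fin 2) ℂ
  | .nil, _, _ => 1
  | .node _ l r, j, q =>
    if j < 2 * l.numNodes + 1 then
      if q < l.numNodes then leafPauli l j q
      else if q = l.numNodes then pauliX else 1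
    else if j = 2 * l.numNodes + 1 then
      if q = l.numNodes then pauliY else 1
    else
      if q < l.numNodes then 1
      else if q = l.numNodes then pauliZ
      else leafPauli r (j - (2 * l.numNodes + 2)) (q - (l.numNodes + 1))

/-- Operators on `N` qubits, as matrices in the computational basis `Fin N → Fin 2`. -/
abbrev QubitOp (N : ℕ) : Type := Matrix (Fin N → Fin 2) (Fin N → Fin 2) ℂ

/-- The tensor product `⨂_q P q` of single-qubit operators. -/
def tensorOp {N : ℕ} (P : Fin N → Matrix (Fin 2) (Fin 2) ℂ) : QubitOp N :=
  Matrix.of fun s u => ∏ q, P q (s q) (u q)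

/-- The image of the Majorana operator `γ_j`, `0 ≤ j < 2 * N`, under the encoding of `N` fermionic
modes given by a tree shape `t` with `N` nodes: the Pauli string of the `j`-th leaf of `t`. The
last (rightmost) leaf is the unused one. -/
def majorana {N : ℕ} (t : TreeShape) (j : Fin (2 * N)) : QubitOp N :=
  tensorOp fun q => leafPauli t j q

/-- `U` performs the basis transformation from the encoding given by `t` to the one given by `t'`:
it is unitary, and conjugation by it carries each encoded Majorana operator of the first encoding to
the corresponding one of the second. -/
def IsBasisTransformation {N : ℕ} (U : QubitOp N) (t t' : TreeShape) : Prop :=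
  U ∈ Matrix.unitaryGroup (Fin N → Fin 2) ℂ ∧
    ∀ j : Fin (2 * N), U * majorana t j * U.conjTranspose = majorana t' j

/-! ### CNOT circuits -/

/-- The gate `CNOT` with control `g.1` and target `g.2`, as a matrix: the basis state `u` is sent to
the basis state in which bit `g.2` is replaced by `u g.2 + u g.1` (modulo two). -/
def cnot {N : ℕ} (g : Fin N × Fin N) : QubitOp N :=
  Matrix.of fun s u => if s = Function.update u g.2 (u g.2 + u g.1) then 1 else 0

/-- `layer` is a legal layer for the connectivity graph `G`: every gate acts on two qubits that are
adjacent in `G`, and no two gates of the layer share a qubit. -/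
def IsLayer {N : ℕ} (G : SimpleGraph (Fin N)) (layer : List (Fin N × Fin N)) : Prop :=
  (∀ g ∈ layer, G.Adj g.1 g.2) ∧
    layer.Pairwise fun g h => g.1 ≠ h.1 ∧ g.1 ≠ h.2 ∧ g.2 ≠ h.1 ∧ g.2 ≠ h.2

/-- A CNOT circuit on `N` qubits respecting the connectivity graph `G`, as the list of its layers
in order of execution. There are no ancillas: all gates act on the `N` qubits. -/
structure CnotCircuit {N : ℕ} (G : SimpleGraph (Fin N)) where
  layers : List (List (Fin N × Fin N))
  isLayer : ∀ layer ∈ layers, IsLayer G layer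

/-- The depth of a circuit: its number of layers. -/
def CnotCircuit.depth {N : ℕ} {G : SimpleGraph (Fin N)} (c : CnotCircuit G) : ℕ :=
  c.layers.length

/-- The product of a list of gates; for a legal layer the factors commute. -/
def layerOp {N : ℕ} (layer : List (Fin N × Fin N)) : QubitOp N :=
  (layer.map cnot).prod

/-- The unitary of a circuit; the first layer is applied first, so it is the rightmost factor. -/
def CnotCircuit.unitary {N : ℕ} {G : SimpleGraph (Fin N)} (c : CnotCircuit G) : QubitOp N :=
  (c.layers.reverse.map layerOp).prod

/-! ### The grid and the Hilbert curve -/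

/-- Nearest-neighbour adjacency on the cells of the `L × L` grid. -/
def gridGraph (L : ℕ) : SimpleGraph (Fin L × Fin L) :=
  (SimpleGraph.pathGraph L).boxProd (SimpleGraph.pathGraph L)

/-- Coordinates of the `i`-th cell of the Hilbert curve of order `m`, which visits the `4 ^ m` cells
of the `2 ^ m × 2 ^ m` grid, from the corner `(0, 0)` to the corner `(2 ^ m - 1, 0)`. The curve of
order `m + 1` runs through a transposed, two translated and an anti-transposed copy of the curve of
order `m`, one in each quadrant. -/
def hilbertCoord : ℕ → ℕ → ℕ × ℕ
  | 0, _ => (0, 0)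
  | m + 1, i =>
    let s := 2 ^ m
    let p := hilbertCoord m (i % 4 ^ m)
    if i / 4 ^ m = 0 then (p.2, p.1)
    else if i / 4 ^ m = 1 then (p.1, p.2 + s)
    else if i / 4 ^ m = 2 then (p.1 + s, p.2 + s)
    else (2 * s - 1 - p.2, s - 1 - p.1)

theorem hilbertCoord_lt (m i : ℕ) :
    (hilbertCoord m i).1 < 2 ^ m ∧ (hilbertCoord m i).2 < 2 ^ m := by
  induction m generalizing i with
  | zero => simp [hilbertCoord]
  | succ m ih =>
    obtain ⟨h1, h2⟩ := ih (i % 4 ^ m)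
    simp only [hilbertCoord]
    rw [pow_succ]
    split_ifs <;> constructor <;> dsimp only <;> omega

/-- The `i`-th cell of the Hilbert curve on the `2 ^ m × 2 ^ m` grid (meaningful for
`i < 4 ^ m`). -/
def hilbertCell (m i : ℕ) : Fin (2 ^ m) × Fin (2 ^ m) :=
  (⟨(hilbertCoord m i).1, (hilbertCoord_lt m i).1⟩, ⟨(hilbertCoord m i).2, (hilbertCoord_lt m i).2⟩)

/-- Connectivity of `N` qubits in the Hilbert layout: qubit `i` sits on the `i`-th cell of the
Hilbert curve on the `2 ^ m × 2 ^ m` grid, and two qubits are adjacent when their cells are nearest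
neighbours. -/
def hilbertLayout (m N : ℕ) : SimpleGraph (Fin N) :=
  (gridGraph (2 ^ m)).comap fun i => hilbertCell m i

end GridFermion

namespace GridFermion

/-! On computational basis states every tree encoding is classical: a qubit stores the parity of its
own mode and of the modes in its left subtree. The string of leaf `j` flips mode `j / 2`, with a
phase that depends on the occupations but not on the tree (`prod_leafPauli_encode`). Hence any
injective map of bit strings that turns one stored form of each occupation state into the other
performs the basis transformation, and only parities remain to be tracked.

With `P k` the parity of the modes below `k`, qubit `q` stores `n q` for JW, `P (q + 1)` for Parity,
and `P (q + 1) + P (q + 1 - b)` for BK, where `b` is the largest power of two dividing `q + 1`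
(`encode_bkTree`). Both conversions go through about `log₂ N` levels. Level `i` adds bit `q - 2 ^ i`
to bit `q`, for all `q` with `q + 1` in one residue class modulo `2 ^ (i + 1)`: class `0` from the
top level down for BK→JW, class `2 ^ i` from the bottom level up for Parity→BK.

Within a level the index intervals from source to target are disjoint, so the long-range CNOTs run
in parallel, each inside its own interval. Such an interval is one cell followed by an aligned block
of `2 ^ i` cells, which the Hilbert curve lays out as one square or two consecutive squares of side
`2 ^ (i / 2)`. A curve enters and leaves a square at the ends of one side, so the walk has `O(2 ^ (i
/ 2))` steps (`exists_stepsIn_dyadic`), and so does the depth of the level (`realizable_stepMap`).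
The geometric sum over the levels is `O(√N)`. -/

open Finset

/-! ### Occupation numbers and their encodings -/

/-- Two is zero in `Fin 2`. -/
theorem add_self_fin_two (a : Fin 2) : a + a = 0 := by
  revert a; decide

/-- The sign `(-1) ^ b`. -/
def bitSign (b : Fin 2) : ℂ := if b = 0 then 1 else -1

theorem bitSign_add (a b : Fin 2) : bitSign (a + b) = bitSign a * bitSign b := by
  fin_cases a <;> fin_cases b <;> simp [bitSign]

theorem bitSign_zero : bitSign 0 = 1 := by simp [bitSign]

theorem pauliX_apply (a b : Fin 2) : pauliX a b = if a = b + 1 then 1 else 0 := by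
  fin_cases a <;> fin_cases b <;> simp [pauliX]

theorem pauliY_apply (a b : Fin 2) :
    pauliY a b = if a = b + 1 then Complex.I * bitSign b else 0 := by
  fin_cases a <;> fin_cases b <;> simp [pauliY, bitSign]

theorem pauliZ_apply (a b : Fin 2) : pauliZ a b = if a = b then bitSign b else 0 := by
  fin_cases a <;> fin_cases b <;> simp [pauliZ, bitSign]

/-- The bits stored by the tree encoding of the occupation numbers `n`: qubit `q` holds the parity
of the occupations of `q` and of the nodes of its left subtree. -/
def encode : TreeShape → (ℕ → Fin 2) → ℕ → Fin 2
  | .nil, _, _ => 0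
  | .node _ l r, n, q =>
    if q < l.numNodes then encode l n q
    else if q = l.numNodes then ∑ k ∈ range (l.numNodes + 1), n k
    else encode r (fun k => n (l.numNodes + 1 + k)) (q - (l.numNodes + 1))

/-- The phase acquired by the occupation state `n` under the Majorana operator `γ_j`. -/
def majoranaPhase (j : ℕ) (n : ℕ → Fin 2) : ℂ :=
  bitSign (∑ k ∈ range (j / 2), n k) *
    if j % 2 = 0 then 1 else Complex.I * bitSign (n (j / 2))

/-- Flip the occupation of mode `i`. -/
def flipMode (n : ℕ → Fin 2) (i : ℕ) : ℕ → Fin 2 := Function.update n i (n i + 1)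

theorem encode_congr (t : TreeShape) {n n' : ℕ → Fin 2} (h : ∀ k < t.numNodes, n k = n' k) (q : ℕ) :
    encode t n q = encode t n' q := by
  induction t generalizing n n' q with
  | nil => rfl
  | node _ l r ihl ihr =>
    simp only [BinaryTree.numNodes] at h
    simp only [encode]
    split_ifs with h1 h2
    · exact ihl (fun k hk => h k (by omega)) q
    · exact sum_congr rfl fun k hk => h k (by rw [mem_range] at hk; omega)
    · exact ihr (fun k hk => h _ (by omega)) _

/-- Once the left subtree is decoded, the root bit determines the root's mode. Surjectivity lets
operators be compared on encoded states alone. -/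
theorem exists_encode_eq (t : TreeShape) (u : ℕ → Fin 2) :
    ∃ n, ∀ q < t.numNodes, encode t n q = u q := by
  induction t generalizing u with
  | nil => exact ⟨0, fun q hq => absurd hq (by simp [BinaryTree.numNodes])⟩
  | node _ l r ihl ihr =>
    obtain ⟨nl, hl⟩ := ihl u
    obtain ⟨nr, hr⟩ := ihr fun k => u (l.numNodes + 1 + k)
    refine ⟨fun k => if k < l.numNodes then nl k else if k = l.numNodes then
      u l.numNodes + ∑ k ∈ range l.numNodes, nl k else nr (k - (l.numNodes + 1)), fun q hq => ?_⟩
    simp only [BinaryTree.numNodes] at hq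
    simp only [encode]
    split_ifs with h1 h2
    · rw [← hl q h1]
      exact encode_congr l (fun k hk => by simp [hk]) q
    · rw [sum_range_succ, sum_congr rfl (g := nl) fun k hk => by simp [mem_range.1 hk]]
      simp only [lt_irrefl, if_false, if_true]
      rw [add_left_comm, add_self_fin_two, add_zero, h2]
    · have := hr (q - (l.numNodes + 1)) (by omega)
      rw [show l.numNodes + 1 + (q - (l.numNodes + 1)) = q by omega] at this
      rw [← this]
      exact encode_congr r (fun k hk => by
        rw [if_neg (by omega), if_neg (by omega), Nat.add_sub_cancel_left]) _

theorem sum_flipMode_of_le (n : ℕ → Fin 2) {i m : ℕ} (h : m ≤ i) :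
    ∑ k ∈ range m, flipMode n i k = ∑ k ∈ range m, n k :=
  sum_congr rfl fun k hk => by
    rw [flipMode, Function.update_of_ne]; rw [mem_range] at hk; omega

theorem sum_flipMode_of_lt (n : ℕ → Fin 2) {i m : ℕ} (h : i < m) :
    ∑ k ∈ range m, flipMode n i k = (∑ k ∈ range m, n k) + 1 := by
  rw [flipMode, sum_update_of_mem (mem_range.2 h), ← add_sum_erase _ _ (mem_range.2 h),
    sdiff_singleton_eq_erase]
  abel

theorem prod_ite_eq_zero (m : ℕ) (p : ℕ → Prop) [DecidablePred p] :
    ∏ q ∈ range m, (if p q then (1 : ℂ) else 0) = if ∀ q < m, p q then 1 else 0 := by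
  rw [prod_ite_zero]; simp

theorem forall_lt_add_one_add (a b : ℕ) (p : ℕ → Prop) :
    (∀ q < a + b + 1, p q) ↔ (∀ q < a, p q) ∧ p a ∧ ∀ q < b, p (a + 1 + q) := by
  refine ⟨fun h => ⟨fun q hq => h q (by omega), h a (by omega), fun q hq => h _ (by omega)⟩, ?_⟩
  rintro ⟨h1, h2, h3⟩ q hq
  rcases lt_trichotomy q a with h | rfl | h
  · exact h1 q h
  · exact h2
  · have := h3 (q - (a + 1)) (by omega)
    rwa [show a + 1 + (q - (a + 1)) = q by omega] at this

theorem ite_mul_ite_mul_ite (p q r : Prop) [Decidable p] [Decidable q] [Decidable r] (x y z : ℂ) :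
    (if p then x else 0) * (if q then y else 0) * (if r then z else 0) =
      if p ∧ q ∧ r then x * y * z else 0 := by
  by_cases p <;> by_cases q <;> by_cases r <;> simp_all

theorem encode_branch_left {l r : TreeShape} {q : ℕ} (h : q < l.numNodes) (n : ℕ → Fin 2) :
    encode (.node () l r) n q = encode l n q := by
  rw [encode, if_pos h]

theorem encode_branch_root (l r : TreeShape) (n : ℕ → Fin 2) :
    encode (.node () l r) n l.numNodes = ∑ k ∈ range (l.numNodes + 1), n k := by
  rw [encode, if_neg (lt_irrefl _), if_pos rfl]

theorem encode_branch_right (l r : TreeShape) (n : ℕ → Fin 2) (q : ℕ) :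
    encode (.node () l r) n (l.numNodes + 1 + q) =
      encode r (fun k => n (l.numNodes + 1 + k)) q := by
  rw [encode, if_neg (by omega), if_neg (by omega), Nat.add_sub_cancel_left]

/-- In every tree encoding, the Pauli string of leaf `j` maps the state encoding `n` to the state
encoding `n` with mode `j / 2` flipped, with a phase that does not depend on the tree. -/
theorem prod_leafPauli_encode (t : TreeShape) (j : ℕ) (hj : j ≤ 2 * t.numNodes)
    (n s : ℕ → Fin 2) :
    ∏ q ∈ range t.numNodes, leafPauli t j q (s q) (encode t n q) =
      if ∀ q < t.numNodes, s q = encode t (flipMode n (j / 2)) q then majoranaPhase j n else 0 := by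
  induction t generalizing j n s with
  | nil =>
    simp only [BinaryTree.numNodes] at hj
    obtain rfl : j = 0 := by omega
    simp [BinaryTree.numNodes, majoranaPhase, bitSign_zero]
  | node v l r ihl ihr =>
    obtain ⟨⟩ := v
    simp only [BinaryTree.numNodes] at hj ⊢
    have hprod (F : ℕ → ℂ) : ∏ q ∈ range (l.numNodes + r.numNodes + 1), F q =
        (∏ q ∈ range l.numNodes, F q) * F l.numNodes *
          ∏ q ∈ range r.numNodes, F (l.numNodes + 1 + q) := by
      rw [add_right_comm, prod_range_add, prod_range_succ]
    have hel (n' : ℕ → Fin 2) : (∀ q < l.numNodes, s q = encode (.node () l r) n' q) ↔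
        ∀ q < l.numNodes, s q = encode l n' q :=
      forall₂_congr fun q hq => by rw [encode_branch_left hq]
    rw [hprod]
    simp only [forall_lt_add_one_add, hel, encode_branch_root, encode_branch_right]
    have hleft (h : l.numNodes ≤ j / 2) (q : ℕ) :
        encode l (flipMode n (j / 2)) q = encode l n q :=
      encode_congr l (fun k hk => by rw [flipMode, Function.update_of_ne]; omega) q
    have hright (h : j / 2 ≤ l.numNodes) : (fun k => flipMode n (j / 2) (l.numNodes + 1 + k)) =
        fun k => n (l.numNodes + 1 + k) := by
      funext k; rw [flipMode, Function.update_of_ne (by omega)]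
    -- Leaf `j` lies in the left subtree, is the middle leaf, or lies in the right subtree. In the
    -- first two cases the flipped mode enters the root's parity, matching `X` and `Y`; in the third
    -- it does not, and `Z` supplies the sign of all modes before the right subtree. The last leaf
    -- must be covered too, since in a left subtree it is a used leaf of the whole tree.
    rcases lt_trichotomy j (2 * l.numNodes + 1) with h | h | h
    · have hL : ∏ q ∈ range l.numNodes, leafPauli (.node () l r) j q (s q)
          (encode (.node () l r) n q) =
          if ∀ q < l.numNodes, s q = encode l (flipMode n (j / 2)) q then
            majoranaPhase j n else 0 := by
        rw [← ihl j (by omega) n s]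
        refine prod_congr rfl fun q hq => ?_
        rw [encode_branch_left (mem_range.1 hq), leafPauli, if_pos h, if_pos (mem_range.1 hq)]
      have hM : leafPauli (.node () l r) j l.numNodes = pauliX := by
        rw [leafPauli, if_pos h, if_neg (lt_irrefl _), if_pos rfl]
      have hR (q : ℕ) : leafPauli (.node () l r) j (l.numNodes + 1 + q) = 1 := by
        rw [leafPauli, if_pos h, if_neg (by omega), if_neg (by omega)]
      simp only [hL, hM, hR, pauliX_apply, Matrix.one_apply, prod_ite_eq_zero,
        ite_mul_ite_mul_ite, mul_one]
      rw [sum_flipMode_of_lt n (by omega), hright (by omega)]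
    · have hL : ∏ q ∈ range l.numNodes, leafPauli (.node () l r) j q (s q)
          (encode (.node () l r) n q) =
          if ∀ q < l.numNodes, s q = encode l n q then 1 else 0 := by
        rw [← prod_ite_eq_zero]
        refine prod_congr rfl fun q hq => ?_
        rw [encode_branch_left (mem_range.1 hq), leafPauli, if_neg h.not_lt, if_pos h,
          if_neg (mem_range.1 hq).ne, Matrix.one_apply]
      have hM : leafPauli (.node () l r) j l.numNodes = pauliY := by
        rw [leafPauli, if_neg h.not_lt, if_pos h, if_pos rfl]
      have hR (q : ℕ) : leafPauli (.node () l r) j (l.numNodes + 1 + q) = 1 := by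
        rw [leafPauli, if_neg h.not_lt, if_pos h, if_neg (by omega)]
      have hph : majoranaPhase j n =
          Complex.I * bitSign (∑ k ∈ range (l.numNodes + 1), n k) := by
        rw [majoranaPhase, if_neg (by omega), show j / 2 = l.numNodes by omega, sum_range_succ,
          bitSign_add]
        ring
      simp only [hL, hM, hR, pauliY_apply, Matrix.one_apply, prod_ite_eq_zero,
        ite_mul_ite_mul_ite, mul_one, one_mul, hleft (show l.numNodes ≤ j / 2 by omega)]
      rw [sum_flipMode_of_lt n (by omega), hright (by omega), hph]
    · have hL : ∏ q ∈ range l.numNodes, leafPauli (.node () l r) j q (s q)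
          (encode (.node () l r) n q) =
          if ∀ q < l.numNodes, s q = encode l n q then 1 else 0 := by
        rw [← prod_ite_eq_zero]
        refine prod_congr rfl fun q hq => ?_
        rw [encode_branch_left (mem_range.1 hq), leafPauli, if_neg h.not_gt, if_neg h.ne',
          if_pos (mem_range.1 hq), Matrix.one_apply]
      have hM : leafPauli (.node () l r) j l.numNodes = pauliZ := by
        rw [leafPauli, if_neg h.not_gt, if_neg h.ne', if_neg (lt_irrefl _), if_pos rfl]
      have hR (q : ℕ) : leafPauli (.node () l r) j (l.numNodes + 1 + q) =
          leafPauli r (j - (2 * l.numNodes + 2)) q := by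
        rw [leafPauli, if_neg h.not_gt, if_neg h.ne', if_neg (by omega), if_neg (by omega),
          Nat.add_sub_cancel_left]
      have hshift : (fun k => flipMode n (j / 2) (l.numNodes + 1 + k)) =
          flipMode (fun k => n (l.numNodes + 1 + k)) ((j - (2 * l.numNodes + 2)) / 2) := by
        funext k
        by_cases hk : l.numNodes + 1 + k = j / 2
        · obtain rfl : k = (j - (2 * l.numNodes + 2)) / 2 := by omega
          rw [flipMode, flipMode, hk, Function.update_self, Function.update_self]
        · rw [flipMode, flipMode, Function.update_of_ne hk, Function.update_of_ne (by omega)]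
      have hph : majoranaPhase j n = bitSign (∑ k ∈ range (l.numNodes + 1), n k) *
          majoranaPhase (j - (2 * l.numNodes + 2)) fun k => n (l.numNodes + 1 + k) := by
        have h2 : j / 2 = l.numNodes + 1 + (j - (2 * l.numNodes + 2)) / 2 := by omega
        have h3 : j % 2 = (j - (2 * l.numNodes + 2)) % 2 := by omega
        rw [majoranaPhase, majoranaPhase, h2, sum_range_add, bitSign_add, h3, mul_assoc]
      have ihr := ihr (j - (2 * l.numNodes + 2)) (by omega) (fun k => n (l.numNodes + 1 + k))
        fun k => s (l.numNodes + 1 + k)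
      simp only [hL, hM, hR, pauliZ_apply, ihr, ite_mul_ite_mul_ite, one_mul,
        hleft (show l.numNodes ≤ j / 2 by omega)]
      rw [sum_flipMode_of_le n (by omega), hshift, hph]

/-! ### Classical reversible maps as operators -/

/-- The operator that sends the basis state `u` to the basis state `f u`. -/
def basisMap {N : ℕ} (f : (Fin N → Fin 2) → Fin N → Fin 2) : QubitOp N :=
  Matrix.of fun s u => if s = f u then 1 else 0

theorem basisMap_mul {N : ℕ} (f g : (Fin N → Fin 2) → Fin N → Fin 2) :
    basisMap f * basisMap g = basisMap (f ∘ g) := by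
  ext s u
  simp [basisMap, Matrix.mul_apply]

theorem basisMap_id {N : ℕ} : basisMap (id : (Fin N → Fin 2) → Fin N → Fin 2) = 1 := by
  ext s u
  simp [basisMap, Matrix.one_apply]

theorem basisMap_mem_unitaryGroup {N : ℕ} {f : (Fin N → Fin 2) → Fin N → Fin 2}
    (hf : Function.Injective f) : basisMap f ∈ Matrix.unitaryGroup (Fin N → Fin 2) ℂ := by
  rw [Matrix.mem_unitaryGroup_iff']
  ext s u
  simp [basisMap, Matrix.mul_apply, Matrix.one_apply, Matrix.star_apply, hf.eq_iff, eq_comm]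

theorem majorana_encode {N : ℕ} {t : TreeShape} (ht : t.numNodes = N) (j : Fin (2 * N))
    (n : ℕ → Fin 2) (s : Fin N → Fin 2) :
    majorana t j s (fun q => encode t n q) =
      if s = (fun q : Fin N => encode t (flipMode n (j / 2)) q) then majoranaPhase j n else 0 := by
  have h := prod_leafPauli_encode t j (by omega) n fun q => if h : q < N then s ⟨q, h⟩ else 0
  rw [ht, prod_range] at h
  simp only [Fin.is_lt, dif_pos, Fin.eta] at h
  rw [majorana, tensorOp, Matrix.of_apply, h]
  refine if_congr ⟨fun h => ?_, ?_⟩ rfl rfl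
  · funext q
    simpa using h q q.2
  · rintro rfl q hq
    simp [hq]

/-- A reversible map of bit strings that carries the bits of every occupation state in the first
encoding to those in the second performs the basis transformation. -/
theorem isBasisTransformation_basisMap {N : ℕ} {t t' : TreeShape} (ht : t.numNodes = N)
    (ht' : t'.numNodes = N) {f : (Fin N → Fin 2) → Fin N → Fin 2} (hf : Function.Injective f)
    (h : ∀ n : ℕ → Fin 2, f (fun q => encode t n q) = fun q : Fin N => encode t' n q) :
    IsBasisTransformation (basisMap f) t t' := by
  have hU := basisMap_mem_unitaryGroup hf
  refine ⟨hU, fun j => ?_⟩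
  have key : basisMap f * majorana t j = majorana t' j * basisMap f := by
    ext s u
    -- Each column `u` is the encoding of some occupation state, where both sides have the same
    -- phase and the same flipped mode.
    obtain ⟨n, hn⟩ := exists_encode_eq t fun q => if h : q < N then u ⟨q, h⟩ else 0
    obtain rfl : (fun q : Fin N => encode t n q) = u := by
      funext q
      rw [hn q (by omega)]
      simp
    simp only [Matrix.mul_apply, majorana_encode ht, basisMap, Matrix.of_apply, h]
    simp [h, majorana_encode ht']
  rw [key, mul_assoc]
  rw [Matrix.mem_unitaryGroup_iff] at hU
  rw [← Matrix.star_eq_conjTranspose, hU, mul_one]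

/-! ### Walks along the Hilbert curve -/

/-- `StepsIn R A d a b`: there is a walk of `d` steps of the relation `R` from `a` to `b` that stays
in `A`. -/
inductive StepsIn {V : Type*} (R : V → V → Prop) (A : Set V) : ℕ → V → V → Prop
  | refl (a : V) (ha : a ∈ A) : StepsIn R A 0 a a
  | cons {d : ℕ} {a b c : V} (ha : a ∈ A) (hab : R a b) (h : StepsIn R A d b c) :
      StepsIn R A (d + 1) a c

namespace StepsIn

variable {V : Type*} {R : V → V → Prop} {A B : Set V} {d e : ℕ} {a b c : V}

theorem trans (h : StepsIn R A d a b) (h' : StepsIn R A e b c) : StepsIn R A (d + e) a c := by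
  induction h with
  | refl a ha => rwa [Nat.zero_add]
  | cons ha hab _ ih =>
    rw [Nat.add_right_comm]
    exact cons ha hab (ih h')

theorem mono (h : StepsIn R A d a b) (hAB : A ⊆ B) : StepsIn R B d a b := by
  induction h with
  | refl a ha => exact refl a (hAB ha)
  | cons ha hab _ ih => exact cons (hAB ha) hab ih

theorem map {W : Type*} {S : W → W → Prop} {B : Set W} (φ : V → W) (h : StepsIn R A d a b)
    (hA : ∀ v ∈ A, φ v ∈ B) (hR : ∀ v ∈ A, ∀ w ∈ A, R v w → S (φ v) (φ w)) :
    StepsIn S B d (φ a) (φ b) := by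
  induction h with
  | refl a ha => exact refl _ (hA a ha)
  | cons ha hab h ih =>
    refine cons (hA _ ha) (hR _ ha _ ?_ hab) ih
    cases h <;> assumption

end StepsIn

/-- Two points of `ℕ × ℕ` are nearest neighbours. -/
def IsNeighbour (p q : ℕ × ℕ) : Prop :=
  (p.1 + 1 = q.1 ∨ q.1 + 1 = p.1) ∧ p.2 = q.2 ∨ (p.2 + 1 = q.2 ∨ q.2 + 1 = p.2) ∧ p.1 = q.1

/-- The cells with indices `i` and `j` of the Hilbert curve of order `m` are nearest neighbours. -/
def HilbertAdj (m i j : ℕ) : Prop := IsNeighbour (hilbertCoord m i) (hilbertCoord m j)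

theorem hilbertLayout_adj {m N : ℕ} (i j : Fin N) :
    (hilbertLayout m N).Adj i j ↔ HilbertAdj m i j := by
  simp [hilbertLayout, gridGraph, SimpleGraph.boxProd_adj, SimpleGraph.pathGraph_adj, hilbertCell,
    HilbertAdj, IsNeighbour]

/-- Each quadrant carries an isometric copy of the smaller curve. -/
theorem hilbertAdj_succ {m i j : ℕ} (h : i / 4 ^ m = j / 4 ^ m)
    (hij : HilbertAdj m (i % 4 ^ m) (j % 4 ^ m)) : HilbertAdj (m + 1) i j := by
  have hi := hilbertCoord_lt m (i % 4 ^ m)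
  have hj := hilbertCoord_lt m (j % 4 ^ m)
  simp only [HilbertAdj, IsNeighbour, hilbertCoord, h] at hij ⊢
  split_ifs <;> dsimp only <;> omega

/-- Aligned blocks of `4 ^ k` cells are congruent to the curve of order `k`. -/
theorem hilbertAdj_of_block {m k i j : ℕ} (hk : k ≤ m) (hi : i < 4 ^ m) (hj : j < 4 ^ m)
    (h : i / 4 ^ k = j / 4 ^ k) (hij : HilbertAdj k (i % 4 ^ k) (j % 4 ^ k)) :
    HilbertAdj m i j := by
  induction m, hk using Nat.le_induction generalizing i j with
  | base => rwa [Nat.mod_eq_of_lt hi, Nat.mod_eq_of_lt hj] at hij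
  | succ m hk ih =>
    have hd : 4 ^ k ∣ 4 ^ m := pow_dvd_pow 4 hk
    have hpos : 0 < 4 ^ m := by positivity
    have hq : i / 4 ^ m = j / 4 ^ m := by
      obtain ⟨c, hc⟩ := hd
      rw [hc, ← Nat.div_div_eq_div_mul, ← Nat.div_div_eq_div_mul, h]
    refine hilbertAdj_succ hq (ih (Nat.mod_lt _ hpos) (Nat.mod_lt _ hpos) ?_ ?_)
    · have e (x : ℕ) : x % 4 ^ m / 4 ^ k = x / 4 ^ k % (4 ^ m / 4 ^ k) := by
        obtain ⟨c, hc⟩ := hd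
        rw [hc, Nat.mul_div_cancel_left _ (by positivity), Nat.mod_mul_right_div_self]
      rw [e, e, h]
    · rwa [Nat.mod_mod_of_dvd _ hd, Nat.mod_mod_of_dvd _ hd]

theorem hilbertCoord_zero_right (m : ℕ) : hilbertCoord m 0 = (0, 0) := by
  induction m with
  | zero => rfl
  | succ m ih => simp [hilbertCoord, ih]

theorem hilbertCoord_add (m c i : ℕ) (hi : i < 4 ^ m) :
    hilbertCoord (m + 1) (c * 4 ^ m + i) =
      if c = 0 then ((hilbertCoord m i).2, (hilbertCoord m i).1)
      else if c = 1 then ((hilbertCoord m i).1, (hilbertCoord m i).2 + 2 ^ m)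
      else if c = 2 then ((hilbertCoord m i).1 + 2 ^ m, (hilbertCoord m i).2 + 2 ^ m)
      else (2 * 2 ^ m - 1 - (hilbertCoord m i).2, 2 ^ m - 1 - (hilbertCoord m i).1) := by
  have h1 : (c * 4 ^ m + i) / 4 ^ m = c := by
    rw [mul_comm, Nat.mul_add_div (by positivity), Nat.div_eq_of_lt hi, add_zero]
  have h2 : (c * 4 ^ m + i) % 4 ^ m = i := by
    rw [mul_comm, Nat.mul_add_mod, Nat.mod_eq_of_lt hi]
  simp only [hilbertCoord, h1, h2]

theorem hilbertCoord_last (m : ℕ) : hilbertCoord m (4 ^ m - 1) = (2 ^ m - 1, 0) := by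
  induction m with
  | zero => rfl
  | succ m ih =>
    have h4 : 0 < 4 ^ m := by positivity
    have h2 : 0 < 2 ^ m := by positivity
    rw [show 4 ^ (m + 1) - 1 = 3 * 4 ^ m + (4 ^ m - 1) by rw [pow_succ]; omega,
      hilbertCoord_add m 3 _ (by omega), ih]
    simp [pow_succ, mul_comm]

/-- Walks are described by curve indices, so a straight walk through the square needs an index for
each cell it crosses. -/
theorem exists_hilbertCoord_eq (m x y : ℕ) (hx : x < 2 ^ m) (hy : y < 2 ^ m) :
    ∃ i < 4 ^ m, hilbertCoord m i = (x, y) := by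
  induction m generalizing x y with
  | zero => exact ⟨0, by simp, by simp at hx hy; simp [hilbertCoord, hx, hy]⟩
  | succ m ih =>
    have h4 : 0 < 4 ^ m := by positivity
    have key (c x' y' : ℕ) (hc : c < 4) (hx' : x' < 2 ^ m) (hy' : y' < 2 ^ m)
        (h : (if c = 0 then (y', x') else if c = 1 then (x', y' + 2 ^ m)
          else if c = 2 then (x' + 2 ^ m, y' + 2 ^ m)
          else (2 * 2 ^ m - 1 - y', 2 ^ m - 1 - x')) = (x, y)) :
        ∃ i < 4 ^ (m + 1), hilbertCoord (m + 1) i = (x, y) := by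
      obtain ⟨i, hi, h'⟩ := ih x' y' hx' hy'
      refine ⟨c * 4 ^ m + i, ?_, ?_⟩
      · rw [pow_succ]
        nlinarith
      · rw [hilbertCoord_add m c i hi, h', h]
    rw [pow_succ] at hx hy
    by_cases h1 : x < 2 ^ m <;> by_cases h2 : y < 2 ^ m
    · exact key 0 y x (by omega) h2 h1 (by simp)
    · exact key 1 x (y - 2 ^ m) (by omega) h1 (by omega) (by simp; omega)
    · refine key 3 (2 ^ m - 1 - y) (2 * 2 ^ m - 1 - x) (by omega) (by omega) (by omega) ?_
      simp only [OfNat.ofNat_ne_zero, OfNat.ofNat_ne_one, if_false, Prod.mk.injEq,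
        show ¬ 3 = 2 by omega]
      omega
    · refine key 2 (x - 2 ^ m) (y - 2 ^ m) (by omega) (by omega) (by omega) ?_
      simp
      omega

/-- Consecutive cells of the Hilbert curve are nearest neighbours. -/
theorem hilbertAdj_add_one {m i : ℕ} (hi : i + 1 < 4 ^ m) : HilbertAdj m i (i + 1) := by
  induction m generalizing i with
  | zero => simp at hi
  | succ m ih =>
    have h4 : 0 < 4 ^ m := by positivity
    have h2 : 0 < 2 ^ m := by positivity
    rw [pow_succ] at hi
    have hdm := Nat.div_add_mod' i (4 ^ m)
    have hlt := Nat.mod_lt i h4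
    set c := i / 4 ^ m
    set r := i % 4 ^ m
    by_cases hr : r + 1 < 4 ^ m
    · have := ih hr
      refine hilbertAdj_succ ?_ ?_
      · rw [← hdm, add_assoc, mul_comm, Nat.mul_add_div h4, Nat.mul_add_div h4,
          Nat.div_eq_of_lt hr, Nat.div_eq_of_lt hlt]
      · rw [← hdm, add_assoc, mul_comm, Nat.mul_add_mod, Nat.mul_add_mod,
          Nat.mod_eq_of_lt hr, Nat.mod_eq_of_lt hlt]
        exact this
    · have hr' : r = 4 ^ m - 1 := by omega
      have hi1 : i + 1 = (c + 1) * 4 ^ m + 0 := by rw [add_mul]; omega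
      have hc : c < 3 := by
        by_contra! h
        have : 3 * 4 ^ m ≤ c * 4 ^ m := Nat.mul_le_mul_right _ h
        omega
      rw [HilbertAdj, hi1, ← hdm, hilbertCoord_add m _ _ hlt, hilbertCoord_add m _ _ h4, hr',
        hilbertCoord_last, hilbertCoord_zero_right]
      interval_cases c <;> simp [IsNeighbour] <;> omega

/-- The endpoints of a curve of order `k` are joined by a side of the square. -/
theorem stepsIn_side (k : ℕ) :
    StepsIn (HilbertAdj k) {i | i < 4 ^ k} (2 ^ k - 1) 0 (4 ^ k - 1) := by
  have h4 : 0 < 4 ^ k := by positivity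
  have h2 : 0 < 2 ^ k := by positivity
  -- `d` is the distance left to the final corner. Starting at `d = 1` allows a step directly to
  -- index `4 ^ k - 1`; starting at `0` would require injectivity of the curve.
  have key (d : ℕ) (hd0 : 0 < d) (hd : d < 2 ^ k) : ∀ i < 4 ^ k,
      hilbertCoord k i = (2 ^ k - 1 - d, 0) →
      StepsIn (HilbertAdj k) {i | i < 4 ^ k} d i (4 ^ k - 1) := by
    induction d, hd0 using Nat.le_induction with
    | base =>
      intro i hi h
      refine .cons hi ?_ (.refl _ (Nat.sub_lt h4 one_pos))
      rw [HilbertAdj, h, hilbertCoord_last]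
      exact .inl ⟨.inl (by dsimp only; omega), rfl⟩
    | succ d hd0 ih =>
      intro i hi h
      obtain ⟨i', hi', h'⟩ := exists_hilbertCoord_eq k (2 ^ k - 1 - d) 0 (by omega) h2
      refine .cons hi ?_ (ih (by omega) i' hi' h')
      rw [HilbertAdj, h, h']
      exact .inl ⟨.inl (by dsimp only; omega), rfl⟩
  rcases Nat.eq_zero_or_pos (2 ^ k - 1) with h | h
  · obtain rfl : k = 0 := by
      by_contra h0
      have := Nat.one_lt_two_pow h0
      omega
    exact .refl _ (by simp)
  · refine key _ h (by omega) 0 h4 ?_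
    rw [hilbertCoord_zero_right, Nat.sub_self]

/-- The endpoints of an aligned block of `4 ^ k` cells are joined by a side of its square. -/
theorem stepsIn_block {m k b : ℕ} (hk : k ≤ m) (hb : (b + 1) * 4 ^ k ≤ 4 ^ m) :
    StepsIn (HilbertAdj m) (Set.Ico (b * 4 ^ k) ((b + 1) * 4 ^ k)) (2 ^ k - 1)
      (b * 4 ^ k) ((b + 1) * 4 ^ k - 1) := by
  have h4 : 0 < 4 ^ k := by positivity
  rw [add_mul, one_mul] at hb ⊢
  have := (stepsIn_side k).map (S := HilbertAdj m)
    (B := Set.Ico (b * 4 ^ k) (b * 4 ^ k + 4 ^ k)) (fun i => b * 4 ^ k + i) (fun i hi => by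
      simp only [Set.mem_ofPred_eq] at hi
      exact ⟨by omega, by omega⟩) (fun i hi j hj hij => by
      simp only [Set.mem_ofPred_eq] at hi hj
      refine hilbertAdj_of_block hk (by omega) (by omega) ?_ ?_
      · rw [mul_comm, Nat.mul_add_div h4, Nat.mul_add_div h4, Nat.div_eq_of_lt hi,
          Nat.div_eq_of_lt hj]
      · rwa [mul_comm, Nat.mul_add_mod, Nat.mul_add_mod, Nat.mod_eq_of_lt hi,
          Nat.mod_eq_of_lt hj])
  rwa [add_zero, ← Nat.add_sub_assoc h4] at this

/-- The last cell before an aligned block of `2 ^ i` cells is joined to the last cell of the block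
by a walk of `O(√(2 ^ i))` steps. -/
theorem exists_stepsIn_dyadic {m i q : ℕ} (hq : q < 4 ^ m) (hi : 2 ^ i ≤ q) (hd : 2 ^ i ∣ q + 1) :
    ∃ d ≤ 2 * 2 ^ (i / 2), StepsIn (HilbertAdj m) (Set.Icc (q - 2 ^ i) q) d (q - 2 ^ i) q := by
  have hpos : 0 < 2 ^ i := by positivity
  obtain ⟨b, hb⟩ := hd
  set k := i / 2 with hk
  have h2 : 0 < 2 ^ k := by positivity
  have h4 : 0 < 4 ^ k := by positivity
  have h44 : (4 : ℕ) ^ k = 2 ^ (2 * k) := by rw [pow_mul]; norm_num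
  have hkm : k ≤ m := by
    have h : 4 ^ k ≤ 2 ^ i := by
      rw [h44]
      exact Nat.pow_le_pow_right (by omega) (by omega)
    exact ((Nat.pow_lt_pow_iff_right (by omega : 1 < 4)).1 (by omega : 4 ^ k < 4 ^ m)).le
  have hfirst : StepsIn (HilbertAdj m) (Set.Icc (q - 2 ^ i) q) 1 (q - 2 ^ i) (q - 2 ^ i + 1) :=
    .cons ⟨le_rfl, by omega⟩ (hilbertAdj_add_one (by omega)) (.refl _ ⟨by omega, by omega⟩)
  have hb0 : b ≠ 0 := by rintro rfl; omega
  obtain ⟨b, rfl⟩ := Nat.exists_eq_succ_of_ne_zero hb0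
  -- For even `i` the block is one square: `1 + (2 ^ k - 1)` steps. For odd `i` it is two
  -- consecutive squares joined by a curve step: `2 * 2 ^ k` steps in all.
  rcases Nat.even_or_odd' i with ⟨k', h | h⟩
  · obtain rfl : k = k' := by omega
    rw [h, ← h44, Nat.succ_eq_add_one, mul_comm] at hb
    rw [h, ← h44] at hfirst hi ⊢
    have hs := stepsIn_block (m := m) (k := k) (b := b) hkm (by omega)
    rw [← hb, Nat.add_sub_cancel] at hs
    rw [add_mul] at hb
    rw [show b * 4 ^ k = q - 4 ^ k + 1 by omega] at hs
    exact ⟨_, by omega, hfirst.trans (hs.mono fun x hx => ⟨by have := hx.1; omega,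
      Nat.lt_succ_iff.1 hx.2⟩)⟩
  · obtain rfl : k = k' := by omega
    have h2i : 2 ^ i = 2 * 4 ^ k := by rw [h, pow_succ, ← h44, mul_comm]
    rw [h2i] at hfirst hi hb ⊢
    have e1 : (2 * b + 1 + 1) * 4 ^ k = q + 1 := by rw [hb, Nat.succ_eq_add_one]; ring
    have e2 : (2 * b + 1) * 4 ^ k = q + 1 - 4 ^ k := by
      rw [add_mul, one_mul] at e1; omega
    have e3 : (2 * b) * 4 ^ k = q - 2 * 4 ^ k + 1 := by
      rw [add_mul, one_mul] at e2; omega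
    have hs1 := stepsIn_block (m := m) (k := k) (b := 2 * b) hkm (by omega)
    have hs2 := stepsIn_block (m := m) (k := k) (b := 2 * b + 1) hkm (by omega)
    rw [e2, e3] at hs1
    rw [e1, e2, Nat.add_sub_cancel] at hs2
    have hmid : StepsIn (HilbertAdj m) (Set.Icc (q - 2 * 4 ^ k) q) 1 (q + 1 - 4 ^ k - 1)
        (q + 1 - 4 ^ k) := by
      have := hilbertAdj_add_one (m := m) (i := q + 1 - 4 ^ k - 1) (by omega)
      rw [show q + 1 - 4 ^ k - 1 + 1 = q + 1 - 4 ^ k by omega] at this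
      exact .cons ⟨by omega, by omega⟩ this (.refl _ ⟨by omega, by omega⟩)
    refine ⟨_, ?_, ((hfirst.trans (hs1.mono ?_)).trans hmid).trans (hs2.mono ?_)⟩
    · omega
    · exact fun x hx => ⟨by have := hx.1; omega, by have := hx.2; omega⟩
    · exact fun x hx => ⟨by have := hx.1; omega, by have := hx.2; omega⟩

/-! ### The action of a circuit on basis states -/

variable {N : ℕ} {G : SimpleGraph (Fin N)}

/-- The action of a CNOT gate on basis states. -/
def gateMap (g : Fin N × Fin N) (u : Fin N → Fin 2) : Fin N → Fin 2 :=
  Function.update u g.2 (u g.2 + u g.1)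

/-- The action of a layer on basis states. -/
def layerMap : List (Fin N × Fin N) → (Fin N → Fin 2) → Fin N → Fin 2
  | [] => id
  | g :: l => gateMap g ∘ layerMap l

/-- The action of a list of layers on basis states. -/
def circuitMap : List (List (Fin N × Fin N)) → (Fin N → Fin 2) → Fin N → Fin 2
  | [] => id
  | l :: ls => circuitMap ls ∘ layerMap l

theorem layerMap_append (l l' : List (Fin N × Fin N)) :
    layerMap (l ++ l') = layerMap l ∘ layerMap l' := by
  induction l with
  | nil => rfl
  | cons g l ih => rw [List.cons_append, layerMap, layerMap, ih, Function.comp_assoc]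

theorem circuitMap_append (ls ls' : List (List (Fin N × Fin N))) :
    circuitMap (ls ++ ls') = circuitMap ls' ∘ circuitMap ls := by
  induction ls with
  | nil => rfl
  | cons g l ih => rw [List.cons_append, circuitMap, circuitMap, ih, Function.comp_assoc]

theorem layerOp_eq_basisMap (l : List (Fin N × Fin N)) : layerOp l = basisMap (layerMap l) := by
  induction l with
  | nil => exact basisMap_id.symm
  | cons g l ih =>
    rw [layerMap, ← basisMap_mul, ← ih]
    rfl

theorem CnotCircuit.unitary_eq_basisMap (c : CnotCircuit G) :
    c.unitary = basisMap (circuitMap c.layers) := by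
  rw [CnotCircuit.unitary]
  induction c.layers with
  | nil => exact basisMap_id.symm
  | cons l ls ih =>
    rw [circuitMap, ← basisMap_mul, ← ih, ← layerOp_eq_basisMap]
    simp

theorem gateMap_involutive {g : Fin N × Fin N} (hg : g.1 ≠ g.2) :
    Function.Involutive (gateMap g) := fun u => by
  simp [gateMap, Function.update_of_ne hg, add_assoc, add_self_fin_two]

theorem layerMap_injective {l : List (Fin N × Fin N)} (hl : ∀ g ∈ l, g.1 ≠ g.2) :
    Function.Injective (layerMap l) := by
  induction l with
  | nil => exact Function.injective_id
  | cons g l ih =>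
    rw [List.forall_mem_cons] at hl
    exact (gateMap_involutive hl.1).injective.comp (ih hl.2)

theorem circuitMap_injective {ls : List (List (Fin N × Fin N))} (h : ∀ l ∈ ls, IsLayer G l) :
    Function.Injective (circuitMap ls) := by
  induction ls with
  | nil => exact Function.injective_id
  | cons l ls ih =>
    rw [List.forall_mem_cons] at h
    exact (ih h.2).comp (layerMap_injective fun g hg => (h.1.1 g hg).ne)

theorem commute_gateMap {g h : Fin N × Fin N} (h1 : g.1 ≠ h.2) (h2 : g.2 ≠ h.1) (h3 : g.2 ≠ h.2) :
    Function.Commute (gateMap g) (gateMap h) := fun u => by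
  simp only [gateMap]
  rw [Function.update_of_ne h1, Function.update_of_ne h3, Function.update_of_ne h2.symm,
    Function.update_of_ne h3.symm, Function.update_comm h3]

theorem commute_layerMap {f : (Fin N → Fin 2) → Fin N → Fin 2} {l : List (Fin N × Fin N)}
    (h : ∀ g ∈ l, Function.Commute f (gateMap g)) : Function.Commute f (layerMap l) := by
  induction l with
  | nil => exact Function.Commute.id_right
  | cons g l ih =>
    rw [List.forall_mem_cons] at h
    exact h.1.comp_right (ih h.2)

theorem commute_circuitMap {f : (Fin N → Fin 2) → Fin N → Fin 2}
    {ls : List (List (Fin N × Fin N))} (h : ∀ l ∈ ls, Function.Commute f (layerMap l)) :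
    Function.Commute f (circuitMap ls) := by
  induction ls with
  | nil => exact Function.Commute.id_right
  | cons g l ih =>
    rw [List.forall_mem_cons] at h
    exact (ih h.2).comp_right h.1

/-! ### Maps realized by circuits of given depth and support -/

/-- `f` is the action of a circuit of depth `D` on `G` all of whose gates act on qubits in `A`. -/
def Realizable (G : SimpleGraph (Fin N)) (A : Set (Fin N)) (D : ℕ)
    (f : (Fin N → Fin 2) → Fin N → Fin 2) : Prop :=
  ∃ ls : List (List (Fin N × Fin N)), ls.length = D ∧
    (∀ l ∈ ls, IsLayer G l ∧ ∀ g ∈ l, g.1 ∈ A ∧ g.2 ∈ A) ∧ circuitMap ls = f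

namespace Realizable

variable {A B : Set (Fin N)} {D E : ℕ} {f g : (Fin N → Fin 2) → Fin N → Fin 2}

theorem id (A : Set (Fin N)) (D : ℕ) : Realizable G A D id := by
  refine ⟨List.replicate D [], List.length_replicate, fun l hl => ?_, ?_⟩
  · obtain rfl := List.eq_of_mem_replicate hl
    exact ⟨⟨by simp, List.Pairwise.nil⟩, by simp⟩
  · induction D with
    | zero => rfl
    | succ D ih => rw [List.replicate_succ, circuitMap, ih]; rfl

theorem comp (hf : Realizable G A D f) (hg : Realizable G A E g) :
    Realizable G A (D + E) (g ∘ f) := by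
  obtain ⟨ls, rfl, hls, rfl⟩ := hf
  obtain ⟨ls', rfl, hls', rfl⟩ := hg
  refine ⟨ls ++ ls', List.length_append, fun l hl => ?_, circuitMap_append _ _⟩
  rcases List.mem_append.1 hl with h | h
  exacts [hls l h, hls' l h]

/-- Empty layers pad a circuit, so circuits can be brought to the equal length needed to merge them
layer by layer. -/
theorem mono (hf : Realizable G A D f) (hAB : A ⊆ B) (hDE : D ≤ E) : Realizable G B E f := by
  have : Realizable G B D f := by
    obtain ⟨ls, h, hls, rfl⟩ := hf
    exact ⟨ls, h, fun l hl => ⟨(hls l hl).1, fun g hg =>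
      ⟨hAB ((hls l hl).2 g hg).1, hAB ((hls l hl).2 g hg).2⟩⟩, rfl⟩
  have := this.comp (Realizable.id B (E - D))
  rwa [Nat.add_sub_cancel' hDE] at this

theorem gate {a b : Fin N} (h : G.Adj a b) (ha : a ∈ A) (hb : b ∈ A) :
    Realizable G A 1 (gateMap (a, b)) :=
  ⟨[[(a, b)]], rfl, by simp [IsLayer, h, ha, hb], rfl⟩

/-- Circuits with disjoint supports can be run in parallel. -/
theorem parallel (hAB : Disjoint A B) (hf : Realizable G A D f) (hg : Realizable G B D g) :
    Realizable G (A ∪ B) D (f ∘ g) := by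
  obtain ⟨ls, hD, hls, rfl⟩ := hf
  obtain ⟨ls', hD', hls', rfl⟩ := hg
  refine ⟨List.zipWith (· ++ ·) ls ls', by simp [hD, hD'], ?_⟩
  rw [← hD'] at hD
  clear hD'
  have hne {a b : Fin N} (ha : a ∈ A) (hb : b ∈ B) : a ≠ b := fun h =>
    Set.disjoint_left.1 hAB ha (h ▸ hb)
  induction ls generalizing ls' with
  | nil =>
    obtain rfl : ls' = [] := List.length_eq_zero_iff.1 hD.symm
    exact ⟨by simp, rfl⟩
  | cons l ls ih =>
    obtain _ | ⟨l', ls'⟩ := ls'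
    · simp at hD
    rw [List.forall_mem_cons] at hls hls'
    obtain ⟨ih1, ih2⟩ := ih hls.2 ls' (by simpa using hD) hls'.2
    rw [List.zipWith_cons_cons, List.forall_mem_cons]
    refine ⟨⟨⟨⟨fun g hg => ?_, ?_⟩, fun g hg => ?_⟩, ih1⟩, ?_⟩
    · rcases List.mem_append.1 hg with h | h
      exacts [hls.1.1.1 g h, hls'.1.1.1 g h]
    · refine List.pairwise_append.2 ⟨hls.1.1.2, hls'.1.1.2, fun g hg h hh => ?_⟩
      obtain ⟨g1, g2⟩ := hls.1.2 g hg
      obtain ⟨h1, h2⟩ := hls'.1.2 h hh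
      exact ⟨hne g1 h1, hne g1 h2, hne g2 h1, hne g2 h2⟩
    · rcases List.mem_append.1 hg with h | h
      · exact ⟨.inl (hls.1.2 g h).1, .inl (hls.1.2 g h).2⟩
      · exact ⟨.inr (hls'.1.2 g h).1, .inr (hls'.1.2 g h).2⟩
    -- Gates with disjoint supports commute, so the first layer on `A` can be moved past the rest of
    -- the circuit on `B`.
    · have hcomm : Function.Commute (layerMap l) (circuitMap ls') := by
        refine commute_circuitMap fun m hm => commute_layerMap fun h hh =>
          (commute_layerMap fun g hg => ?_).symm
        obtain ⟨g1, g2⟩ := hls.1.2 g hg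
        obtain ⟨h1, h2⟩ := (hls'.2 m hm).2 h hh
        exact commute_gateMap (hne g2 h1).symm (hne g1 h2).symm (hne g2 h2).symm
      rw [circuitMap, ih2, circuitMap, circuitMap, layerMap_append]
      funext u
      simp only [Function.comp_apply]
      rw [← hcomm.eq]

/-- A CNOT between the ends of a walk takes at most four gates for each step of the walk. -/
theorem gate_of_stepsIn {a b : Fin N} {d : ℕ} (h : StepsIn G.Adj A d a b) (hab : a ≠ b) :
    Realizable G A (4 * d) (gateMap (a, b)) := by
  induction h with
  | refl a ha => exact absurd rfl hab
  | @cons d a v b ha hav h ih =>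
    have hv : v ∈ A := by cases h <;> assumption
    by_cases hvb : v = b
    · subst hvb
      exact (gate hav ha hv).mono le_rfl (by omega)
    · have key := ((((gate hav.symm hv ha).comp (gate hav ha hv)).comp (ih hvb)).comp
        (gate hav ha hv)).comp (gate hav.symm hv ha)
      have e : 4 * (d + 1) = 1 + 1 + 4 * d + 1 + 1 := by ring
      rw [e]
      convert key using 1
      have hav' := hav.ne
      funext u q
      have h2 (x y : Fin 2) : x + (x + y) = y := by
        rw [← add_assoc, add_self_fin_two, zero_add]
      by_cases h1 : q = a
      · subst h1
        simp [gateMap, hav', hav'.symm, hab, Ne.symm hab, hvb, Ne.symm hvb, add_comm,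
          add_left_comm, h2, add_self_fin_two]
      by_cases h3 : q = v
      · subst h3
        simp [gateMap, hav', hav'.symm, hab, Ne.symm hab, hvb, Ne.symm hvb, add_comm,
          add_left_comm, h2, add_self_fin_two]
      by_cases h4 : q = b
      · subst h4
        simp [gateMap, hav', hav'.symm, hab, Ne.symm hab, hvb, Ne.symm hvb, add_comm,
          add_left_comm, h2, add_self_fin_two]
      · simp [gateMap, Function.update_apply, h1, h3, h4]

end Realizable

/-! ### The bits of the three encodings -/

/-- The parity of the occupations of the modes below `k`. -/
def prefixParity (n : ℕ → Fin 2) (k : ℕ) : Fin 2 := ∑ i ∈ range k, n i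

theorem encode_jwTree {N q : ℕ} (hq : q < N) (n : ℕ → Fin 2) : encode (jwTree N) n q = n q := by
  induction N generalizing q n with
  | zero => omega
  | succ N ih =>
    rcases q with _ | q
    · simp [jwTree, encode]
    · simp [jwTree, encode, ih (show q < N by omega), add_comm]

theorem encode_parityTree {N q : ℕ} (hq : q < N) (n : ℕ → Fin 2) :
    encode (parityTree N) n q = prefixParity n (q + 1) := by
  induction N with
  | zero => omega
  | succ N ih =>
    simp only [parityTree, TreeShape.branch, encode, numNodes_parityTree]
    split_ifs with h1 h2
    · exact ih h1
    · rw [h2, prefixParity]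
    · omega

theorem prefixParity_shift (n : ℕ → Fin 2) (p k : ℕ) :
    prefixParity (fun i => n (p + i)) k = prefixParity n p + prefixParity n (p + k) := by
  rw [prefixParity, prefixParity, prefixParity, sum_range_add, ← add_assoc, add_self_fin_two,
    zero_add]

/-- A power of two dividing `r` or `2 ^ a + r` is less than `2 ^ (a + 1)`, hence divides `2 ^ a`.
Thus passing to a right subtree does not change block lengths. -/
theorem gcd_two_pow_add {a K r : ℕ} (hr : 0 < r) (hra : r < 2 ^ a) :
    Nat.gcd (2 ^ a + r) (2 ^ K) = Nat.gcd r (2 ^ K) := by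
  apply Nat.dvd_antisymm
  · refine Nat.dvd_gcd ?_ (Nat.gcd_dvd_right _ _)
    obtain ⟨v, -, hv⟩ := (Nat.dvd_prime_pow Nat.prime_two).1 (Nat.gcd_dvd_right (2 ^ a + r) (2 ^ K))
    have hd := Nat.gcd_dvd_left (2 ^ a + r) (2 ^ K)
    rw [hv] at hd ⊢
    have hva : v < a + 1 := (Nat.pow_lt_pow_iff_right one_lt_two).1
      ((Nat.le_of_dvd (by omega) hd).trans_lt (by rw [pow_succ]; omega))
    exact (Nat.dvd_add_right (pow_dvd_pow 2 (Nat.lt_succ_iff.1 hva))).1 hd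
  · refine Nat.dvd_gcd ?_ (Nat.gcd_dvd_right _ _)
    obtain ⟨v, -, hv⟩ := (Nat.dvd_prime_pow Nat.prime_two).1 (Nat.gcd_dvd_right r (2 ^ K))
    have hd := Nat.gcd_dvd_left r (2 ^ K)
    rw [hv] at hd ⊢
    have hva : v < a := (Nat.pow_lt_pow_iff_right one_lt_two).1
      ((Nat.le_of_dvd hr hd).trans_lt hra)
    exact (Nat.dvd_add_right (pow_dvd_pow 2 hva.le)).2 hd

/-- The bits of the Bravyi--Kitaev encoding with blocks of at most `2 ^ i` modes: qubit `q` holds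
the parity of the modes below `q + 1` from the last `gcd (q + 1) (2 ^ i)` ones. -/
def fenwickBit (i : ℕ) (n : ℕ → Fin 2) (q : ℕ) : Fin 2 :=
  prefixParity n (q + 1) + prefixParity n (q + 1 - Nat.gcd (q + 1) (2 ^ i))

theorem fenwickBit_zero (n : ℕ → Fin 2) (q : ℕ) : fenwickBit 0 n q = n q := by
  rw [fenwickBit, pow_zero, Nat.gcd_one_right, Nat.add_sub_cancel, prefixParity, sum_range_succ,
    add_right_comm, prefixParity, add_self_fin_two, zero_add]

/-- At the root `q + 1` is a power of two and the block is the whole prefix. In the right subtree,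
shifting by this power keeps the block length, and the prefix parity of the shift cancels. The bound
on `N` makes the cap `2 ^ K` inactive. -/
theorem encode_bkTree {N q K : ℕ} (hK : N < 2 ^ K) (hq : q < N) (n : ℕ → Fin 2) :
    encode (bkTree N) n q = fenwickBit K n q := by
  induction N using Nat.strong_induction_on generalizing q n with
  | _ N ih =>
    have hN : N ≠ 0 := by omega
    have hle := Nat.pow_log_le_self 2 hN
    have hlt := Nat.lt_pow_succ_log_self one_lt_two N
    have hpos := Nat.two_pow_pos (Nat.log 2 N)
    have hlogK : Nat.log 2 N ≤ K :=
      ((Nat.pow_lt_pow_iff_right one_lt_two).1 (hle.trans_lt hK)).le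
    rw [pow_succ] at hlt
    rw [bkTree, if_neg hN]
    simp only [encode, numNodes_bkTree]
    rw [Nat.sub_add_cancel hpos]
    split_ifs with h1 h2
    · exact ih _ (by omega) (by omega) h1 n
    · rw [fenwickBit, show q + 1 = 2 ^ Nat.log 2 N by omega,
        Nat.gcd_eq_left (pow_dvd_pow 2 hlogK), Nat.sub_self]
      simp [prefixParity]
    · obtain ⟨r, rfl⟩ : ∃ r, q = 2 ^ Nat.log 2 N + r := ⟨q - 2 ^ Nat.log 2 N, by omega⟩
      rw [Nat.add_sub_cancel_left, ih _ (by omega) (by omega) (by omega), fenwickBit, fenwickBit,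
        prefixParity_shift, prefixParity_shift, add_add_add_comm, add_self_fin_two, zero_add,
        add_assoc (2 ^ Nat.log 2 N) r 1, gcd_two_pow_add (Nat.succ_pos r) (by omega),
        Nat.add_sub_assoc (Nat.gcd_le_left _ (Nat.succ_pos r))]

/-- The bits half way between the parity and the Bravyi--Kitaev encoding: qubit `q` already has its
final value if `2 ^ i` does not divide `q + 1`. -/
def partialFenwickBit (i : ℕ) (n : ℕ → Fin 2) (q : ℕ) : Fin 2 :=
  if 2 ^ i ∣ q + 1 then prefixParity n (q + 1) else fenwickBit i n q

theorem partialFenwickBit_zero (n : ℕ → Fin 2) (q : ℕ) :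
    partialFenwickBit 0 n q = prefixParity n (q + 1) := by
  simp [partialFenwickBit]

theorem partialFenwickBit_eq_fenwickBit {K q : ℕ} (h : q + 1 < 2 ^ K) (n : ℕ → Fin 2) :
    partialFenwickBit K n q = fenwickBit K n q := by
  rw [partialFenwickBit, if_neg fun hd => absurd (Nat.le_of_dvd (by omega) hd) (by omega)]

theorem gcd_two_pow_succ_of_not_dvd {k i : ℕ} (h : ¬ 2 ^ (i + 1) ∣ k) :
    Nat.gcd k (2 ^ (i + 1)) = Nat.gcd k (2 ^ i) := by
  apply Nat.dvd_antisymm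
  · refine Nat.dvd_gcd (Nat.gcd_dvd_left _ _) ?_
    obtain ⟨v, hvi, hv⟩ := (Nat.dvd_prime_pow Nat.prime_two).1 (Nat.gcd_dvd_right k (2 ^ (i + 1)))
    have hd := Nat.gcd_dvd_left k (2 ^ (i + 1))
    rw [hv] at hd ⊢
    refine pow_dvd_pow 2 ?_
    by_contra! h'
    exact h ((pow_dvd_pow 2 h').trans hd)
  · exact Nat.gcd_dvd_gcd_of_dvd_right _ (pow_dvd_pow 2 (Nat.le_succ i))

/-! ### One level of the Fenwick tree -/

/-- The qubits `q ≥ 2 ^ i` with `q + 1` congruent to `c` modulo `2 ^ (i + 1)`. -/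
def levelTargets (i c : ℕ) : Set ℕ := {q | 2 ^ i ≤ q ∧ (q + 1) % 2 ^ (i + 1) = c}

open Classical in
/-- Add bit `q - 2 ^ i` to bit `q` for all `q` in `T`. -/
noncomputable def stepMap {N : ℕ} (i : ℕ) (T : Set ℕ) (u : Fin N → Fin 2) (q : Fin N) : Fin 2 :=
  if (q : ℕ) ∈ T then u q + u ⟨q - 2 ^ i, (Nat.sub_le _ _).trans_lt q.2⟩ else u q

theorem stepMap_congr {N i : ℕ} {T T' : Set ℕ} {q : Fin N} (h : (q : ℕ) ∈ T ↔ (q : ℕ) ∈ T')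
    (u : Fin N → Fin 2) : stepMap i T u q = stepMap i T' u q := by
  by_cases hT : (q : ℕ) ∈ T
  · rw [stepMap, stepMap, if_pos hT, if_pos (h.1 hT)]
  · rw [stepMap, stepMap, if_neg hT, if_neg (mt h.2 hT)]

/-- Targets of one level are at least `2 ^ (i + 1)` apart, while each gate reaches back only `2 ^
i`. Hence their intervals are disjoint. -/
theorem lt_of_mem_levelTargets {i c q q' : ℕ} (hq : q ∈ levelTargets i c)
    (hq' : q' ∈ levelTargets i c) (h : q < q') : q < q' - 2 ^ i := by
  have hd : 2 ^ (i + 1) ∣ q' + 1 - (q + 1) :=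
    (Nat.modEq_iff_dvd' (by omega)).1 (hq.2.trans hq'.2.symm)
  have := Nat.le_of_dvd (by omega) hd
  have hpos := Nat.two_pow_pos i
  rw [pow_succ] at this
  omega

/-- The largest target `K` is served inside `[K - 2 ^ i, K]`, and all other targets lie below that
interval, so induction runs them in parallel at no extra depth. The `8` is four gates per step times
the factor two in the walk length. -/
theorem realizable_stepMap_inter_Iio {m N : ℕ} (hN : N ≤ 4 ^ m) {i c : ℕ} (hc : 2 ^ i ∣ c) {K : ℕ}
    (hK : K ≤ N) :
    Realizable (hilbertLayout m N) {q | (q : ℕ) < K} (8 * 2 ^ (i / 2))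
      (stepMap i (levelTargets i c ∩ Set.Iio K)) := by
  induction K using Nat.strong_induction_on with
  | _ K ih =>
    rcases K with _ | K
    · convert Realizable.id _ _
      funext u q
      simp [stepMap]
    by_cases hmem : K ∈ levelTargets i c
    · have hpos := Nat.two_pow_pos i
      obtain ⟨d, hd, hs⟩ := exists_stepsIn_dyadic (m := m) (i := i) (q := K) (by omega) hmem.1
        ((Nat.dvd_mod_iff (pow_dvd_pow 2 (Nat.le_succ i))).1 (by rw [hmem.2]; exact hc))
      have hi := hmem.1
      let src : Fin N := ⟨K - 2 ^ i, by omega⟩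
      let tgt : Fin N := ⟨K, by omega⟩
      have hs' : StepsIn (hilbertLayout m N).Adj {q | K - 2 ^ i ≤ (q : ℕ) ∧ (q : ℕ) ≤ K} d
          src tgt := by
        have := hs.map (S := (hilbertLayout m N).Adj)
          (B := {q : Fin N | K - 2 ^ i ≤ (q : ℕ) ∧ (q : ℕ) ≤ K})
          -- The default is never reached: the walk stays at indices at most `K < N`, so no ancilla
          -- cell is used.
          (fun k => if h : k < N then ⟨k, h⟩ else tgt)
          (fun v hv => by
            have h2 := hv.2
            rw [dif_pos (by omega)]
            exact hv)
          (fun v hv w hw hvw => by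
            have h2 := hv.2
            have h3 := hw.2
            rw [dif_pos (by omega), dif_pos (by omega), hilbertLayout_adj]
            exact hvw)
        simpa only [dif_pos (show K - 2 ^ i < N by omega), dif_pos (show K < N by omega)] using this
      have hne : src ≠ tgt := fun h => by
        have := congrArg Fin.val h
        simp only [src, tgt] at this
        omega
      have h1 := (Realizable.gate_of_stepsIn hs' hne).mono le_rfl
        (show 4 * d ≤ 8 * 2 ^ (i / 2) by omega)
      have h2 := ih (K - 2 ^ i) (by omega) (by omega)
      have h12 := Realizable.parallel (Set.disjoint_left.2 fun q hq hq' => by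
        simp only [Set.mem_ofPred_eq] at hq hq'
        omega) h1 h2
      convert h12.mono (B := {q | (q : ℕ) < K + 1}) (fun q hq => by
        simp only [Set.mem_union, Set.mem_ofPred_eq] at hq ⊢
        omega) le_rfl using 1
      funext u q
      by_cases hqK : q = tgt
      · subst hqK
        have hK1 : K ∈ levelTargets i c ∩ Set.Iio (K + 1) := ⟨hmem, Nat.lt_succ_self K⟩
        have hK2 : K ∉ levelTargets i c ∩ Set.Iio (K - 2 ^ i) := fun h => by
          have := h.2
          simp only [Set.mem_Iio] at this
          omega
        -- The source is untouched by the gates below, so its original bit is the one added.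
        have hK3 : K - 2 ^ i ∉ levelTargets i c ∩ Set.Iio (K - 2 ^ i) := fun h =>
          lt_irrefl (K - 2 ^ i) h.2
        simp [gateMap, stepMap, tgt, src, hK1, hK2, hK3]
      · have hq : (q : ℕ) ≠ K := fun h => hqK (Fin.ext h)
        have : (q : ℕ) ∈ levelTargets i c ∩ Set.Iio (K + 1) ↔
            (q : ℕ) ∈ levelTargets i c ∩ Set.Iio (K - 2 ^ i) := by
          refine and_congr_right fun hqm => ⟨fun h => ?_, fun h => ?_⟩
          · exact lt_of_mem_levelTargets hqm hmem (by simp only [Set.mem_Iio] at h; omega)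
          · simp only [Set.mem_Iio] at h ⊢
            omega
        rw [Function.comp_apply, gateMap, Function.update_of_ne hqK]
        exact stepMap_congr this u
    · convert (ih K (by omega) (by omega)).mono (B := {q | (q : ℕ) < K + 1})
        (fun q hq => Nat.lt_succ_of_lt hq) le_rfl using 2
      ext q
      refine and_congr_right fun hqm => ⟨fun h => ?_, fun h => Nat.lt_succ_of_lt h⟩
      exact lt_of_le_of_ne (Nat.lt_succ_iff.1 h) fun h => hmem (h ▸ hqm)

theorem realizable_stepMap {m N : ℕ} (hN : N ≤ 4 ^ m) {i c : ℕ} (hc : 2 ^ i ∣ c) :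
    Realizable (hilbertLayout m N) Set.univ (8 * 2 ^ (i / 2)) (stepMap i (levelTargets i c)) := by
  convert (realizable_stepMap_inter_Iio hN hc le_rfl).mono (Set.subset_univ _) le_rfl using 1
  funext u q
  exact stepMap_congr (iff_self_and.2 fun _ => q.2) u

/-- If `2 ^ (i + 1)` divides `q + 1`, the source index plus one is an odd multiple of `2 ^ i`. Its
bit is the first half of the block of `q`, and adding it leaves the second half. -/
theorem stepMap_fenwickBit {N : ℕ} (i : ℕ) (n : ℕ → Fin 2) :
    stepMap i (levelTargets i 0) (fun q : Fin N => fenwickBit (i + 1) n q) =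
      fun q : Fin N => fenwickBit i n q := by
  funext q
  have hpos := Nat.two_pow_pos i
  have h2 : 2 ^ (i + 1) = 2 ^ i + 2 ^ i := by rw [pow_succ]; omega
  by_cases hd : 2 ^ (i + 1) ∣ (q : ℕ) + 1
  · have hle := Nat.le_of_dvd (by omega) hd
    have hmem : (q : ℕ) ∈ levelTargets i 0 := ⟨by omega, Nat.mod_eq_zero_of_dvd hd⟩
    have hdi : 2 ^ i ∣ (q : ℕ) + 1 := (pow_dvd_pow 2 (Nat.le_succ i)).trans hd
    have hs : (q : ℕ) - 2 ^ i + 1 = q + 1 - 2 ^ i := by omega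
    have hnd : ¬ 2 ^ (i + 1) ∣ (q : ℕ) + 1 - 2 ^ i := fun h => by
      have := (Nat.dvd_sub_iff_right (by omega) hd).1 h
      have := Nat.le_of_dvd hpos this
      omega
    rw [stepMap, if_pos hmem]
    simp only [fenwickBit]
    rw [hs, gcd_two_pow_succ_of_not_dvd hnd, Nat.gcd_eq_right hd, Nat.gcd_eq_right hdi,
      Nat.gcd_eq_right (Nat.dvd_sub hdi dvd_rfl), Nat.sub_sub _ (2 ^ i), ← h2, add_assoc,
      add_left_comm (prefixParity n (q + 1 - 2 ^ (i + 1))), add_self_fin_two, add_zero]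
  · have hmem : (q : ℕ) ∉ levelTargets i 0 := fun h => hd (Nat.dvd_of_mod_eq_zero h.2)
    rw [stepMap, if_neg hmem, fenwickBit, fenwickBit, gcd_two_pow_succ_of_not_dvd hd]

/-- For `q + 1` an odd multiple of `2 ^ i`, source and target both still hold prefix parities, and
their sum is the parity of the last `2 ^ i` modes. -/
theorem stepMap_partialFenwickBit {N : ℕ} (i : ℕ) (n : ℕ → Fin 2) :
    stepMap i (levelTargets i (2 ^ i)) (fun q : Fin N => partialFenwickBit i n q) =
      fun q : Fin N => partialFenwickBit (i + 1) n q := by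
  funext q
  have hpos := Nat.two_pow_pos i
  have h2 : 2 ^ (i + 1) = 2 ^ i + 2 ^ i := by rw [pow_succ]; omega
  have hdvd : 2 ^ i ∣ 2 ^ (i + 1) := pow_dvd_pow 2 (Nat.le_succ i)
  by_cases hd : 2 ^ (i + 1) ∣ (q : ℕ) + 1
  · have hmem : (q : ℕ) ∉ levelTargets i (2 ^ i) := fun h => by
      have := h.2
      rw [Nat.mod_eq_zero_of_dvd hd] at this
      omega
    rw [stepMap, if_neg hmem, partialFenwickBit, partialFenwickBit, if_pos hd,
      if_pos (hdvd.trans hd)]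
  by_cases hdi : 2 ^ i ∣ (q : ℕ) + 1
  · have hmod : ((q : ℕ) + 1) % 2 ^ (i + 1) = 2 ^ i := by
      have h0 : ((q : ℕ) + 1) % 2 ^ (i + 1) ≠ 0 := fun h => hd (Nat.dvd_of_mod_eq_zero h)
      have h1 := Nat.mod_lt ((q : ℕ) + 1) (Nat.two_pow_pos (i + 1))
      obtain ⟨b, hb⟩ := (Nat.dvd_mod_iff hdvd).2 hdi
      rw [hb] at h0 h1 ⊢
      have hb2 : b < 2 := by
        by_contra! h
        have := Nat.mul_le_mul_left (2 ^ i) h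
        omega
      interval_cases b <;> simp at h0 ⊢
    have hgoal : partialFenwickBit (i + 1) n q =
        prefixParity n (q + 1) + prefixParity n (q + 1 - 2 ^ i) := by
      rw [partialFenwickBit, if_neg hd, fenwickBit, gcd_two_pow_succ_of_not_dvd hd,
        Nat.gcd_eq_right hdi]
    have hself : partialFenwickBit i n q = prefixParity n (q + 1) := by
      rw [partialFenwickBit, if_pos hdi]
    rw [hgoal, stepMap]
    by_cases hq : 2 ^ i ≤ (q : ℕ)
    · have hs : (q : ℕ) - 2 ^ i + 1 = q + 1 - 2 ^ i := by omega
      rw [if_pos ⟨hq, hmod⟩, hself, partialFenwickBit, hs, if_pos (Nat.dvd_sub hdi dvd_rfl)]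
    -- Here `q + 1 = 2 ^ i`: there is no source, and the prefix parity is already the final value.
    · rw [if_neg fun h => hq h.1, hself, Nat.sub_eq_zero_of_le (by omega)]
      simp [prefixParity]
  · have hmem : (q : ℕ) ∉ levelTargets i (2 ^ i) := fun h =>
      hdi ((Nat.dvd_mod_iff hdvd).1 (by rw [h.2]))
    rw [stepMap, if_neg hmem, partialFenwickBit, partialFenwickBit, if_neg hd, if_neg hdi,
      fenwickBit, fenwickBit, gcd_two_pow_succ_of_not_dvd hd]

/-! ### The two conversions -/

theorem exists_realizable_fenwickBit {m N : ℕ} (hN : N ≤ 4 ^ m) (K : ℕ) :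
    ∃ f, Realizable (hilbertLayout m N) Set.univ (∑ i ∈ range K, 8 * 2 ^ (i / 2)) f ∧
      ∀ n, f (fun q : Fin N => fenwickBit K n q) = fun q : Fin N => fenwickBit 0 n q := by
  induction K with
  | zero => exact ⟨id, Realizable.id _ _, fun n => rfl⟩
  | succ K ih =>
    obtain ⟨f, hf, h⟩ := ih
    refine ⟨f ∘ stepMap K (levelTargets K 0), ?_, fun n => ?_⟩
    · rw [sum_range_succ, add_comm]
      exact (realizable_stepMap hN (dvd_zero _)).comp hf
    · rw [Function.comp_apply, stepMap_fenwickBit, h]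

theorem exists_realizable_partialFenwickBit {m N : ℕ} (hN : N ≤ 4 ^ m) (K : ℕ) :
    ∃ f, Realizable (hilbertLayout m N) Set.univ (∑ i ∈ range K, 8 * 2 ^ (i / 2)) f ∧
      ∀ n, f (fun q : Fin N => partialFenwickBit 0 n q) =
        fun q : Fin N => partialFenwickBit K n q := by
  induction K with
  | zero => exact ⟨id, Realizable.id _ _, fun n => rfl⟩
  | succ K ih =>
    obtain ⟨f, hf, h⟩ := ih
    refine ⟨stepMap K (levelTargets K (2 ^ K)) ∘ f, ?_, fun n => ?_⟩
    · rw [sum_range_succ]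
      exact hf.comp (realizable_stepMap hN dvd_rfl)
    · rw [Function.comp_apply, h, stepMap_partialFenwickBit]

theorem Realizable.exists_circuit {N D : ℕ} {G : SimpleGraph (Fin N)} {A : Set (Fin N)}
    {f : (Fin N → Fin 2) → Fin N → Fin 2} (hf : Realizable G A D f) {t t' : TreeShape}
    (ht : t.numNodes = N) (ht' : t'.numNodes = N)
    (h : ∀ n : ℕ → Fin 2, f (fun q => encode t n q) = fun q : Fin N => encode t' n q) :
    ∃ c : CnotCircuit G, IsBasisTransformation c.unitary t t' ∧ c.depth = D := by
  obtain ⟨ls, hD, hls, rfl⟩ := hf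
  refine ⟨⟨ls, fun l hl => (hls l hl).1⟩, ?_, hD⟩
  rw [CnotCircuit.unitary_eq_basisMap]
  exact isBasisTransformation_basisMap ht ht'
    (circuitMap_injective fun l hl => (hls l hl).1) h

/-- Raising `K` by two doubles the sum and adds `2`; with the extra `+ 2` both sides exactly double.
-/
theorem sum_two_pow_half_le (K : ℕ) : ∑ i ∈ range K, 2 ^ (i / 2) + 2 ≤ 4 * 2 ^ (K / 2) := by
  induction K using Nat.twoStepInduction with
  | zero => simp
  | one => simp
  | more K ih _ =>
    have e (i : ℕ) : 2 ^ ((i + 2) / 2) = 2 * 2 ^ (i / 2) := by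
      rw [Nat.add_div_right _ two_pos, pow_succ, mul_comm]
    rw [sum_range_succ', sum_range_succ']
    simp only [add_assoc, Nat.reduceAdd, e, ← mul_sum]
    norm_num
    omega

theorem sum_depth_le (N : ℕ) :
    ((∑ i ∈ range (Nat.size N), 8 * 2 ^ (i / 2) : ℕ) : ℝ) ≤ 64 * Real.sqrt N := by
  rcases Nat.eq_zero_or_pos N with rfl | hN
  · simp
  have h1 := sum_two_pow_half_le (Nat.size N)
  have hsize : 0 < Nat.size N := Nat.size_pos.2 hN
  have h2 : 2 ^ (Nat.size N - 1) ≤ N := Nat.lt_size.1 (by omega)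
  have h3 : (2 ^ (Nat.size N / 2)) ^ 2 ≤ 4 * N := by
    calc (2 ^ (Nat.size N / 2)) ^ 2 = 2 ^ (Nat.size N / 2 * 2) := (pow_mul _ _ _).symm
      _ ≤ 2 ^ (Nat.size N - 1 + 1) := Nat.pow_le_pow_right two_pos (by omega)
      _ ≤ 4 * N := by rw [pow_succ]; omega
  have h4 : (2 : ℝ) ^ (Nat.size N / 2) ≤ 2 * Real.sqrt N := by
    refine le_of_pow_le_pow_left₀ two_ne_zero (by positivity) ?_
    rw [mul_pow, Real.sq_sqrt (Nat.cast_nonneg N)]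
    norm_num
    exact_mod_cast h3
  have h5 : ((∑ i ∈ range (Nat.size N), 8 * 2 ^ (i / 2) : ℕ) : ℝ) ≤
      32 * (2 : ℝ) ^ (Nat.size N / 2) := by
    rw [← mul_sum]
    exact_mod_cast (by omega)
  linarith

end GridFermion

open GridFermion in
theorem mainTheorem5 :
    ∃ C : ℝ, ∀ m L N : ℕ, L = 2 ^ m → N ≤ L ^ 2 →
      (∃ c : GridFermion.CnotCircuit (GridFermion.hilbertLayout m N),
        GridFermion.IsBasisTransformation c.unitary
          (GridFermion.bkTree N) (GridFermion.jwTree N) ∧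
        (c.depth : ℝ) ≤ C * Real.sqrt N) ∧
      (∃ c : GridFermion.CnotCircuit (GridFermion.hilbertLayout m N),
        GridFermion.IsBasisTransformation c.unitary
          (GridFermion.parityTree N) (GridFermion.bkTree N) ∧
        (c.depth : ℝ) ≤ C * Real.sqrt N) := by
  -- `64 = 8 * 4 * 2`: depth per level, geometric sum, and `2 ^ (Nat.size N / 2) ≤ 2 * √N`.
  refine ⟨64, fun m L N hL hN => ?_⟩
  have hN4 : N ≤ 4 ^ m := by
    rwa [hL, ← pow_mul, mul_comm, pow_mul] at hN
  have hsize : N < 2 ^ Nat.size N := Nat.lt_size_self N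
  constructor
  · obtain ⟨f, hf, h⟩ := exists_realizable_fenwickBit hN4 (Nat.size N)
    obtain ⟨c, hc, hD⟩ := hf.exists_circuit (numNodes_bkTree N) (numNodes_jwTree N) fun n => by
      simpa only [encode_bkTree hsize (Fin.is_lt _), encode_jwTree (Fin.is_lt _),
        fenwickBit_zero] using h n
    exact ⟨c, hc, by rw [hD]; exact sum_depth_le N⟩
  · obtain ⟨f, hf, h⟩ := exists_realizable_partialFenwickBit hN4 (Nat.size N)
    obtain ⟨c, hc, hD⟩ := hf.exists_circuit (numNodes_parityTree N) (numNodes_bkTree N) fun n => by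
      have e (q : Fin N) : partialFenwickBit (Nat.size N) n q = fenwickBit (Nat.size N) n q :=
        partialFenwickBit_eq_fenwickBit (by omega) n
      simpa only [encode_bkTree hsize (Fin.is_lt _), encode_parityTree (Fin.is_lt _),
        partialFenwickBit_zero, e] using h n
    exact ⟨c, hc, by rw [hD]; exact sum_depth_le N⟩
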